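/- Conventions. Let $X$ be a finite $T_0$-space. For $x\in X$ let $U_x$ be the intersection of all open sets containing $x$, and order $X$ by $x\le y$ if and only if $x\in U_y$. Let $\mathcal K(X)$ be the finite simplicial complex with vertex set $X$ whose simplices are the non-empty chains of $X$. A continuous map $f:X\to Y$ of finite $T_0$-spaces induces the simplicial map $\mathcal K(f):\mathcal K(X)\to\mathcal K(Y)$ that equals $f$ on vertices. The map $f$ is *distinguished* if $f^{-1}(U_y)$ is contractible for every $y\in Y$. A point $x\in X$ is a *weak point* if $U_x\smallsetminus\{x\}$ or $\overline{\{x\}}\smallsetminus\{x\}$ is contractible. Removing a weak point is an *elementary collapse* of finite spaces. A space $Z$ *collapses* to a subspace $A$, or $A$ *expands* to $Z$, if $A$ is obtained from $Z$ by finitely many (possibly zero) elementary collapses. The *non-Hausdorff mapping cylinder* $B(f)$ is the finite $T_0$-space with underlying set $X\sqcup Y$ whose order restricts to the given orders on $X$ and on $Y$, with $x\le y$ if and only if $f(x)\le y$, and never $y\le x$, for $x\in X$, $y\in Y$. Its open sets are the down-sets. For finite simplicial complexes, $K$ collapses to a subcomplex $L$ by an *elementary collapse* if there are a (non-empty) simplex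 $S$ of $K$ and a vertex $a$ of $K$ not in $S$ with $K=L\cup aS$ and $L\cap aS=a\dot S$, where $\dot S$ is the boundary of $S$. An *expansion* is the realization $|L|\to|K|$ of an isomorphism of $L$ onto a subcomplex of $K$ to which $K$ collapses by finitely many (possibly zero) elementary collapses. A homotopy equivalence $|K|\to|L|$ is a *simple homotopy equivalence* if it is homotopic to the composite of a finite sequence of maps $|K|\to|K_1|\to\cdots\to|K_n|\to|L|$ ($K_i$ finite simplicial complexes), each of them an expansion or a homotopy inverse of one. **Theorem.** Let $f:X\to Y$ be a distinguished map between finite $T_0$-spaces. Then $|\mathcal K(f)|:|\mathcal K(X)|\to|\mathcal K(Y)|$ is a simple homotopy equivalence. Moreover, under the canonical inclusions $X\hookrightarrow B(f)$ and $Y\hookrightarrow B(f)$, both $X$ and $Y$ expand to $B(f)$. -/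

import Mathlib

open Topology

universe u

noncomputable section

namespace FiniteSpaces

/-! ### Finite spaces -/

section Spaces

variable {X Y : Type u} [TopologicalSpace X] [TopologicalSpace Y]

/-- The minimal open set `U_x`: the intersection of all open sets containing `x`. -/
def minOpen (x : X) : Set X := nhdsKer {x}

theorem mem_minOpen_iff {a b : X} : a ∈ minOpen b ↔ a ⤳ b := by
  simp only [minOpen, mem_nhdsKer, Set.singleton_subset_iff, specializes_iff_forall_open]

theorem map_mem_minOpen (f : C(X, Y)) {a b : X} (h : a ∈ minOpen b) : f a ∈ minOpen (f b) :=
  mem_minOpen_iff.2 ((mem_minOpen_iff.1 h).map f.continuous)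

/-- The map `f` is distinguished if the preimage of every minimal open set, with the subspace
topology, is contractible. -/
def IsDistinguished (f : C(X, Y)) : Prop :=
  ∀ y : Y, ContractibleSpace (f ⁻¹' minOpen y)

/-- A weak (beat) point: `U_x \ {x}` is contractible or `closure {x} \ {x}` is contractible. -/
def IsWeakPoint (x : X) : Prop :=
  ContractibleSpace ↥(minOpen x \ {x}) ∨ ContractibleSpace ↥(closure {x} \ {x})

/-- Elementary collapse between two subspaces `A`, `A'` of a space: `A'` is obtained from `A` by
removing a weak point of the space `A` (with the subspace topology). -/
def ElementaryCollapse (A A' : Set X) : Prop :=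
  ∃ x : A, IsWeakPoint x ∧ A' = A \ {(x : X)}

/-- The map `i : X → Y` exhibits `Y` as an expansion of `X`: it is a homeomorphism onto a
subspace `i(X)` of `Y`, and `Y` collapses to `i(X)` by a finite sequence of elementary
collapses. -/
def IsSpaceExpansion (i : X → Y) : Prop :=
  IsEmbedding i ∧ Relation.ReflTransGen ElementaryCollapse Set.univ (Set.range i)

end Spaces

/-! ### The non-Hausdorff mapping cylinder -/

section Cylinder

variable {X Y : Type u} [TopologicalSpace X] [TopologicalSpace Y]

/-- The underlying set `X ⊔ Y` of the non-Hausdorff mapping cylinder of `f`. -/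
def Cylinder (_f : C(X, Y)) : Type u := X ⊕ Y

namespace Cylinder

/-- The order of the cylinder. In a finite space `a ≤ b` means `a ∈ U_b`. -/
def le (f : C(X, Y)) : X ⊕ Y → X ⊕ Y → Prop
  | .inl a, .inl b => a ∈ minOpen b
  | .inr a, .inr b => a ∈ minOpen b
  | .inl a, .inr b => f a ∈ minOpen b
  | .inr _, .inl _ => False

/-- The topology associated to the order: the open sets are the down-sets. -/
instance (f : C(X, Y)) : TopologicalSpace (Cylinder f) where
  IsOpen s := ∀ a b : X ⊕ Y, le f a b → b ∈ s → a ∈ s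
  isOpen_univ _ _ _ _ := trivial
  isOpen_inter _ _ hs ht a b hab hb := ⟨hs a b hab hb.1, ht a b hab hb.2⟩
  isOpen_sUnion _ h a b hab := fun ⟨t, ht, hb⟩ => ⟨t, ht, h t ht a b hab hb⟩

/-- The inclusion of `X`. -/
def inl (f : C(X, Y)) (x : X) : Cylinder f := Sum.inl x

/-- The inclusion of `Y`. -/
def inr (f : C(X, Y)) (y : Y) : Cylinder f := Sum.inr y

theorem le_refl (f : C(X, Y)) (a : X ⊕ Y) : le f a a := by
  cases a <;> exact mem_minOpen_iff.2 specializes_rfl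

theorem le_trans (f : C(X, Y)) {a b c : X ⊕ Y} (hab : le f a b) (hbc : le f b c) :
    le f a c := by
  rcases a with a | a <;> rcases b with b | b <;> rcases c with c | c <;>
    simp only [le, mem_minOpen_iff] at hab hbc ⊢
  · exact hab.trans hbc
  · exact (hab.map f.continuous).trans hbc
  · exact hab.trans hbc
  · exact hab.trans hbc

/-- The preorder associated to the topology of the cylinder is the order that defines it. -/
theorem mem_minOpen_iff_le (f : C(X, Y)) (a b : Cylinder f) : a ∈ minOpen b ↔ le f a b := by
  rw [mem_minOpen_iff, specializes_iff_forall_open]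
  refine ⟨fun h => h {c | le f c b} (fun _ _ hcd hd => le_trans f hcd hd) (le_refl f b),
    fun h s hs hb => hs a b h hb⟩

/-- The cylinder of a map between T₀-spaces is a T₀-space. -/
instance (f : C(X, Y)) [T0Space X] [T0Space Y] : T0Space (Cylinder f) where
  t0 a b h := by
    have h1 := (mem_minOpen_iff_le f a b).1 (mem_minOpen_iff.2 h.specializes)
    have h2 := (mem_minOpen_iff_le f b a).1 (mem_minOpen_iff.2 h.specializes')
    rcases a with a | a <;> rcases b with b | b <;>
      simp only [le, mem_minOpen_iff] at h1 h2
    · exact congrArg Sum.inl (h1.antisymm h2).eq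
    · exact congrArg Sum.inr (h1.antisymm h2).eq

/-- The cylinder of a map between finite spaces is finite. -/
instance (f : C(X, Y)) [Finite X] [Finite Y] : Finite (Cylinder f) :=
  inferInstanceAs (Finite (X ⊕ Y))

end Cylinder

end Cylinder

/-! ### Finite simplicial complexes, their realizations and simplicial maps -/

/-- A finite simplicial complex: an abstract simplicial complex on a finite set of vertices. -/
structure FinComplex : Type (u + 1) where
  /-- the vertices -/
  Vertex : Type u
  [fintype : Fintype Vertex]
  /-- the simplices -/
  cplx : AbstractSimplicialComplex Vertex

attribute [instance] FinComplex.fintype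

/-- The geometric realization `|K|`: the points of the standard simplex on the vertices of `K`
(with the Euclidean topology) whose support spans a simplex of `K`. -/
def FinComplex.Realization (K : FinComplex.{u}) : Type u :=
  {p : stdSimplex ℝ K.Vertex // ∃ s ∈ K.cplx, ∀ v, p v ≠ 0 → v ∈ s}

instance (K : FinComplex.{u}) : TopologicalSpace K.Realization :=
  inferInstanceAs (TopologicalSpace {_p : stdSimplex ℝ K.Vertex // _})

open Classical in
/-- Simplicial maps: maps of vertices which send simplices to simplices. -/
structure SimplicialMap (K L : FinComplex.{u}) where
  /-- the map on vertices -/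
  toFun : K.Vertex → L.Vertex
  image_mem : ∀ s ∈ K.cplx, s.image toFun ∈ L.cplx

/-- The realization `|φ| : |K| → |L|`, the affine extension of the map on vertices. -/
def SimplicialMap.realize {K L : FinComplex.{u}} (φ : SimplicialMap K L) :
    C(K.Realization, L.Realization) where
  toFun p := ⟨stdSimplex.map φ.toFun p.1, by
    classical
    obtain ⟨s, hs, hp⟩ := p.2
    refine ⟨s.image φ.toFun, by convert φ.image_mem s hs, fun w hw => ?_⟩
    rw [stdSimplex.map_coe, FunOnFinite.linearMap_apply_apply] at hw
    obtain ⟨v, hv, hv0⟩ := Finset.exists_ne_zero_of_sum_ne_zero hw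
    exact Finset.mem_image.2 ⟨v, hp v hv0, by simpa using hv⟩⟩
  continuous_toFun :=
    ((stdSimplex.continuous_map φ.toFun).comp continuous_subtype_val).subtype_mk _

/-! ### Simplicial collapses -/

section Collapse

variable {V : Type u}

/-- The complex of all faces of the simplex with vertex set `S`. -/
def fullSimplex (S : Finset V) : PreAbstractSimplicialComplex V where
  faces := {t | t.Nonempty ∧ t ⊆ S}
  isRelLowerSet_faces _ ht := ⟨ht.1, fun _ hu hn => ⟨hn, hu.trans ht.2⟩⟩

open Classical in
/-- The cone with apex `a` over the boundary of the simplex `S`: its simplices are the faces of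
`aS` which do not contain `S`. -/
def coneBoundary (a : V) (S : Finset V) : PreAbstractSimplicialComplex V where
  faces := {t | t.Nonempty ∧ t ⊆ insert a S ∧ ¬ S ⊆ t}
  isRelLowerSet_faces _ ht :=
    ⟨ht.1, fun _ hu hn => ⟨hn, hu.trans ht.2.1, fun h => ht.2.2 (h.trans hu)⟩⟩

open Classical in
/-- Elementary simplicial collapse from `K` to its subcomplex `L`: for some simplex `S` and
vertex `a ∉ S` one has `K = L ∪ aS` and `L ∩ aS = a ∂S`. -/
def ElementarySimplicialCollapse (K L : PreAbstractSimplicialComplex V) : Prop :=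
  ∃ (S : Finset V) (a : V), S.Nonempty ∧ a ∉ S ∧
    K = L ⊔ fullSimplex (insert a S) ∧ L ⊓ fullSimplex (insert a S) = coneBoundary a S

end Collapse

open Classical in
/-- The simplicial map `φ : L → K` is an expansion: it is an isomorphism onto a subcomplex `φ(L)`
of `K`, and `K` collapses to `φ(L)` by a finite sequence of elementary simplicial collapses. -/
def SimplicialMap.IsExpansion {L K : FinComplex.{u}} (φ : SimplicialMap L K) : Prop :=
  Function.Injective φ.toFun ∧
    Relation.ReflTransGen ElementarySimplicialCollapse K.cplx.toPreAbstractSimplicialComplex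
      (L.cplx.toPreAbstractSimplicialComplex.map φ.toFun)

/-! ### Simple homotopy equivalences -/

/-- The maps `g` and `f` are homotopy inverse to each other. -/
def IsHomotopyInverse {A B : Type u} [TopologicalSpace A] [TopologicalSpace B]
    (g : C(B, A)) (f : C(A, B)) : Prop :=
  (g.comp f).Homotopic (ContinuousMap.id A) ∧ (f.comp g).Homotopic (ContinuousMap.id B)

/-- The composites of finite sequences of maps `|K| → |K₁| → ⋯ → |Kₙ| → |L|`, each of them an
expansion or a homotopy inverse of one. -/
inductive IsExpansionComposite :
    {K L : FinComplex.{u}} → C(K.Realization, L.Realization) → Prop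
  | refl (K : FinComplex.{u}) : IsExpansionComposite (ContinuousMap.id K.Realization)
  | expand {K L M : FinComplex.{u}} {g : C(K.Realization, L.Realization)}
      (hg : IsExpansionComposite g) (φ : SimplicialMap L M) (hφ : φ.IsExpansion) :
      IsExpansionComposite (φ.realize.comp g)
  | contract {K L M : FinComplex.{u}} {g : C(K.Realization, L.Realization)}
      (hg : IsExpansionComposite g) (φ : SimplicialMap M L) (hφ : φ.IsExpansion)
      (r : C(L.Realization, M.Realization)) (hr : IsHomotopyInverse r φ.realize) :
      IsExpansionComposite (r.comp g)

/-- A map `|K| → |L|` is a simple homotopy equivalence if it is a homotopy equivalence and is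
homotopic to a composite of expansions and homotopy inverses of expansions. -/
def IsSimpleHomotopyEquiv {K L : FinComplex.{u}} (F : C(K.Realization, L.Realization)) : Prop :=
  (∃ G : C(L.Realization, K.Realization), IsHomotopyInverse G F) ∧
    ∃ g : C(K.Realization, L.Realization), IsExpansionComposite g ∧ F.Homotopic g

/-! ### The simplicial complex of a finite space -/

/-- The complex `𝒦(X)` of a finite T₀-space: its simplices are the nonempty chains of `X`, where
`a ≤ b` means `a ∈ U_b`. -/
def orderComplex (X : Type u) [TopologicalSpace X] [Fintype X] : FinComplex.{u} where
  Vertex := X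
  cplx :=
    { faces := {s | s.Nonempty ∧ IsChain (fun a b => a ∈ minOpen b) (s : Set X)}
      isRelLowerSet_faces := fun _ hs =>
        ⟨hs.1, fun _ ht hn => ⟨hn, hs.2.mono (Finset.coe_subset.2 ht)⟩⟩
      singleton_mem := fun v => by simp [Set.mem_ofPred_eq] }

/-- The simplicial map `𝒦(f) : 𝒦(X) → 𝒦(Y)`, equal to `f` on vertices. -/
def orderComplexMap {X Y : Type u} [TopologicalSpace X] [TopologicalSpace Y] [Fintype X]
    [Fintype Y] (f : C(X, Y)) : SimplicialMap (orderComplex X) (orderComplex Y) where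
  toFun := f
  image_mem := by
    classical
    rintro s ⟨hs, hc⟩
    refine ⟨hs.image _, ?_⟩
    intro a ha b hb hab
    obtain ⟨a', ha', rfl⟩ := Finset.mem_image.1 (Finset.mem_coe.1 ha)
    obtain ⟨b', hb', rfl⟩ := Finset.mem_image.1 (Finset.mem_coe.1 hb)
    exact (hc ha' hb' fun h => hab (h ▸ rfl)).imp (map_mem_minOpen f) (map_mem_minOpen f)

end FiniteSpaces

end

/-! The map `f` is the inclusion of `X` into the cylinder followed by `retraction f`, and that
retraction is a left inverse of the inclusion of `Y`. So it suffices to collapse the cylinder onto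
each end, both as a finite space and on complexes of chains. Both inclusions then realize to
expansions, `retraction f` realizes to a homotopy inverse of the second one, and `𝒦(f)` realizes to
an expansion followed by a homotopy inverse of an expansion.

Towards `Y`, the points of `X` are removed from the top down: when the turn of `x` comes, `f x` is
the least point left above it. Towards `X`, the points of `Y` are removed from the bottom up: what
is left strictly below `y` is a copy of `f ⁻¹' minOpen y`, which is contractible.

The second removal needs more work on complexes. By Stong's argument, a contractible finite T₀-space
reduces to a point by removing beat points (`dismantlable_of_contractibleSpace`). Each such
reduction of the points below `y` shrinks the link of `y` by collapses, until the link is a cone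
(`restrictBelow_collapses`). That collapses give homotopy equivalences is
`ElementarySimplicialCollapse.isHomotopyInverse`.

Throughout, `a ⤳ b` is the relation `a ≤ b`. -/

noncomputable section

namespace FiniteSpaces

/-! ### Beat points and contractible finite spaces -/

section Dismantlable

variable {X : Type u} [TopologicalSpace X]

/-- Two points are comparable if one of them is a specialization of the other. -/
def Comparable (a b : X) : Prop := a ⤳ b ∨ b ⤳ a

/-- A subset is dismantlable if it can be reduced to a point by successively removing points `b`
dominated by another point `c`: every point comparable with `b` is comparable with `c`. -/
inductive Dismantlable : Set X → Prop
  | point (m : X) : Dismantlable {m}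
  | step {B : Set X} {b c : X} (hb : b ∈ B) (hc : c ∈ B) (hne : c ≠ b)
      (hdom : ∀ d ∈ B, Comparable d b → Comparable d c) (h : Dismantlable (B \ {b})) :
      Dismantlable B

theorem wellFounded_specializes [Finite X] [T0Space X] :
    WellFounded fun a b : X => a ⤳ b ∧ a ≠ b := by
  have : IsTrans X fun a b : X => a ⤳ b ∧ a ≠ b :=
    ⟨fun a b c h1 h2 => ⟨h1.1.trans h2.1, fun h => h1.2 (h1.1.antisymm (h ▸ h2.1)).eq⟩⟩
  have : Std.Irrefl fun a b : X => a ⤳ b ∧ a ≠ b := ⟨fun a h => h.2 rfl⟩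
  exact Finite.wellFounded_of_trans_of_irrefl _

theorem wellFounded_specializes_swap [Finite X] [T0Space X] :
    WellFounded fun a b : X => b ⤳ a ∧ b ≠ a := by
  have : IsTrans X fun a b : X => b ⤳ a ∧ b ≠ a :=
    ⟨fun a b c h1 h2 => ⟨h2.1.trans h1.1, fun h => h1.2 (h1.1.antisymm (h ▸ h2.1)).eq⟩⟩
  have : Std.Irrefl fun a b : X => b ⤳ a ∧ b ≠ a := ⟨fun a h => h.2 rfl⟩
  exact Finite.wellFounded_of_trans_of_irrefl _

/-- Here `hdown` says that no `b` has a greatest point strictly below it. Induction from the bottom: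
if `g x < x`, some `d < x` is not below `g x`, yet `d = g d ≤ g x` since `g` is monotone. -/
theorem eq_self_of_specializes [Finite X] [T0Space X]
    (hdown : ∀ b c : X, c ⤳ b → c ≠ b → ∃ d, d ⤳ b ∧ d ≠ b ∧ ¬ d ⤳ c)
    {g : X → X} (hg : Continuous g) (h : ∀ x, g x ⤳ x) (x : X) : g x = x := by
  refine wellFounded_specializes.induction (C := fun x => g x = x) x fun x ih => ?_
  by_contra hne
  obtain ⟨d, hd, hdx, hdc⟩ := hdown x (g x) (h x) hne
  exact hdc (ih d ⟨hd, hdx⟩ ▸ hd.map hg)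

theorem eq_self_of_specializes_swap [Finite X] [T0Space X]
    (hup : ∀ b c : X, b ⤳ c → c ≠ b → ∃ d, b ⤳ d ∧ d ≠ b ∧ ¬ c ⤳ d)
    {g : X → X} (hg : Continuous g) (h : ∀ x, x ⤳ g x) (x : X) : g x = x := by
  refine wellFounded_specializes_swap.induction (C := fun x => g x = x) x fun x ih => ?_
  by_contra hne
  obtain ⟨d, hd, hdx, hdc⟩ := hup x (g x) (h x) hne
  exact hdc (ih d ⟨hd, hdx.symm⟩ ▸ hd.map hg)

/-- A contractible finite `T₀`-space without beat points is a point. -/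
theorem subsingleton_of_contractible [Finite X] [T0Space X] [ContractibleSpace X]
    (hdown : ∀ b c : X, c ⤳ b → c ≠ b → ∃ d, d ⤳ b ∧ d ≠ b ∧ ¬ d ⤳ c)
    (hup : ∀ b c : X, b ⤳ c → c ≠ b → ∃ d, b ⤳ d ∧ d ≠ b ∧ ¬ c ⤳ d) : Subsingleton X := by
  obtain ⟨y, ⟨H⟩⟩ := id_nullhomotopic X
  have hH (t) : Continuous fun x => H (t, x) := by fun_prop
  -- Minimal open sets are neighbourhoods and there are finitely many points, so moving slightly in
  -- time can only lower the map `H (t, ·)`.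
  have key (t₀ : unitInterval) : ∀ᶠ t in 𝓝 t₀, ∀ x, H (t, x) ⤳ H (t₀, x) := by
    refine Filter.eventually_all.2 fun x => ?_
    have hc : Continuous fun t => H (t, x) := by fun_prop
    have h1 : nhdsKer {H (t₀, x)} ∈ 𝓝 (H (t₀, x)) :=
      isOpen_nhdsKer.mem_nhds (subset_nhdsKer rfl)
    filter_upwards [hc.continuousAt h1] with t ht
    exact mem_minOpen_iff.1 ht
  -- Nearby times give comparable maps, and a continuous map comparable with the identity is the
  -- identity: `hup` gives closedness, `hdown` openness. Connectedness carries `H = id` from time 0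
  -- to time 1, where `H` is constant.
  have hT : IsClopen {t : unitInterval | ∀ x, H (t, x) = x} := by
    constructor
    · rw [← isOpen_compl_iff, isOpen_iff_mem_nhds]
      intro t₀ ht₀
      filter_upwards [key t₀] with t ht h
      exact ht₀ fun x => eq_self_of_specializes_swap hup (hH t₀)
        (fun z => by simpa only [h z] using ht z) x
    · rw [isOpen_iff_mem_nhds]
      intro t₀ ht₀
      filter_upwards [key t₀] with t ht
      exact fun x => eq_self_of_specializes hdown (hH t)
        (fun z => by simpa only [ht₀ z] using ht z) x
  have h1 : (1 : unitInterval) ∈ {t : unitInterval | ∀ x, H (t, x) = x} := by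
    rw [hT.eq_univ ⟨0, fun x => by simp⟩]
    trivial
  have h2 (x : X) : y = x := by simpa using h1 x
  exact ⟨fun a b => (h2 a).symm.trans (h2 b)⟩

theorem contractibleSpace_of_retract {A B : Type*} [TopologicalSpace A] [TopologicalSpace B]
    [ContractibleSpace B] (i : C(A, B)) (r : C(B, A)) (h : ∀ a, r (i a) = a) :
    ContractibleSpace A := by
  rw [contractible_iff_id_nullhomotopic]
  have h1 := ((id_nullhomotopic B).comp_right r).comp_left i
  convert! h1 using 1
  ext a
  exact (h a).symm

theorem continuous_of_specializes {A B : Type*} [TopologicalSpace A] [TopologicalSpace B]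
    [Finite A] {g : A → B} (h : ∀ a b : A, a ⤳ b → g a ⤳ g b) : Continuous g where
  isOpen_preimage s hs := by
    rw [isOpen_iff_forall_specializes]
    exact fun a b hab hb => (h a b hab).mem_open hs hb

/-- Removing a point from a contractible set is possible if the set retracts onto the rest. -/
theorem contractibleSpace_diff_singleton [Finite X] {B : Set X} [ContractibleSpace B] {b c : X}
    (hc : c ∈ B) (hne : c ≠ b) (h1 : ∀ d ∈ B, d ≠ b → d ⤳ b → d ⤳ c)
    (h2 : ∀ d ∈ B, d ≠ b → b ⤳ d → c ⤳ d) : ContractibleSpace ↥(B \ {b}) := by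
  classical
  -- The retraction sends `b` to `c` and fixes the rest; `h1` and `h2` make it monotone.
  refine contractibleSpace_of_retract
    ⟨Set.inclusion Set.sdiff_subset, continuous_inclusion Set.sdiff_subset⟩
    ⟨fun d : B => if hd : (d : X) = b then ⟨c, hc, hne⟩ else ⟨d, d.2, hd⟩, ?_⟩ ?_
  · refine continuous_of_specializes fun d e hde => ?_
    rw [subtype_specializes_iff] at hde ⊢
    by_cases hd : (d : X) = b <;> by_cases he : (e : X) = b <;> simp only [hd, he, dite_true,
      dite_false]
    · exact specializes_rfl
    · exact h2 e e.2 he (hd ▸ hde)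
    · exact h1 d d.2 hd (he ▸ hde)
    · exact hde
  · rintro ⟨d, hd, hdb⟩
    exact dif_neg hdb

/-- Contractible finite `T₀`-spaces are dismantlable. -/
theorem dismantlable_of_contractibleSpace [Finite X] [T0Space X] (B : Set X)
    [hB : ContractibleSpace B] : Dismantlable B := by
  induction hn : B.ncard generalizing B with
  | zero =>
    rw [Set.ncard_eq_zero] at hn
    subst hn
    exact (not_isEmpty_of_nonempty (∅ : Set X) inferInstance).elim
  | succ n ih =>
    have hrec (b : X) (hb : b ∈ B) (h : ContractibleSpace ↥(B \ {b})) :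
        Dismantlable (B \ {b}) :=
      ih _ (by rw [Set.ncard_sdiff_singleton_of_mem hb, hn]; rfl)
    by_cases hdown : ∀ b c : B, c ⤳ b → c ≠ b → ∃ d, d ⤳ b ∧ d ≠ b ∧ ¬ d ⤳ c
    · by_cases hup : ∀ b c : B, b ⤳ c → c ≠ b → ∃ d, b ⤳ d ∧ d ≠ b ∧ ¬ c ⤳ d
      · have := subsingleton_of_contractible hdown hup
        obtain ⟨m⟩ : Nonempty B := inferInstance
        have : B = {(m : X)} := Set.Subset.antisymm
          (fun z hz => congrArg Subtype.val (Subsingleton.elim (⟨z, hz⟩ : B) m))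
          (Set.singleton_subset_iff.2 m.2)
        rw [this]
        exact .point _
      · push Not at hup
        -- An up beat point: `c` is the least point of `B` strictly above `b`, so it dominates `b`.
        obtain ⟨b, c, hbc, hne, h⟩ := hup
        simp only [subtype_specializes_iff, Subtype.forall, ne_eq, Subtype.ext_iff] at hbc hne h
        refine .step b.2 c.2 hne (fun d hd hdb => ?_) (hrec b b.2 ?_)
        · by_cases hdb' : d = b
          · exact .inl (hdb' ▸ hbc)
          · exact hdb.imp (fun h' => h'.trans hbc) fun h' => h d hd h' hdb'
        · exact contractibleSpace_diff_singleton c.2 hne (fun d _ _ h' => h'.trans hbc)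
            fun d hd h1 h2 => h d hd h2 h1
    · push Not at hdown
      -- Dually, `c` is the greatest point of `B` strictly below `b`.
      obtain ⟨b, c, hbc, hne, h⟩ := hdown
      simp only [subtype_specializes_iff, Subtype.forall, ne_eq, Subtype.ext_iff] at hbc hne h
      refine .step b.2 c.2 hne (fun d hd hdb => ?_) (hrec b b.2 ?_)
      · by_cases hdb' : d = b
        · exact .inr (hdb' ▸ hbc)
        · exact hdb.imp (fun h' => h d hd h' hdb') fun h' => hbc.trans h'
      · exact contractibleSpace_diff_singleton c.2 hne (fun d hd h1 h2 => h d hd h2 h1)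
          fun d _ _ h' => hbc.trans h'

end Dismantlable

/-! ### Simplicial collapses of faces whose link is a cone -/

section Collapses

variable {V : Type u}

/-- The subcomplex of the simplices of `K` which do not have `σ` as a face. -/
def deleteFace (K : PreAbstractSimplicialComplex V) (σ : Finset V) :
    PreAbstractSimplicialComplex V where
  faces := {s | s ∈ K.faces ∧ ¬ σ ⊆ s}
  isRelLowerSet_faces _ hs := ⟨(K.isRelLowerSet_faces hs.1).1, fun _ ht hn =>
    ⟨(K.isRelLowerSet_faces hs.1).2 ht hn, fun h => hs.2 (h.trans ht)⟩⟩

open Classical in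
/-- If `S` and `cS` are the only simplices of `K` with face `S`, removing them is an elementary
collapse. -/
theorem elementarySimplicialCollapse_deleteFace (K : PreAbstractSimplicialComplex V)
    {S : Finset V} {c : V} (hS : S.Nonempty) (hc : c ∉ S) (hcS : insert c S ∈ K.faces)
    (h : ∀ t ∈ K.faces, S ⊆ t → t ⊆ insert c S) :
    ElementarySimplicialCollapse K (deleteFace K S) := by
  refine ⟨S, c, hS, hc, ?_, ?_⟩
  · ext t
    constructor
    · intro ht
      by_cases hSt : S ⊆ t
      · exact .inr ⟨(K.isRelLowerSet_faces ht).1, h t ht hSt⟩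
      · exact .inl ⟨ht, hSt⟩
    · rintro (ht | ht)
      · exact ht.1
      · exact (K.isRelLowerSet_faces hcS).2 ht.2 ht.1
  · ext t
    constructor
    · exact fun ht => ⟨ht.2.1, ht.2.2, ht.1.2⟩
    · exact fun ht => ⟨⟨(K.isRelLowerSet_faces hcS).2 ht.2.1 ht.1, ht.2.2⟩, ht.1, ht.2.1⟩

open Classical in
/-- If the link of `σ` in `K` is a cone with apex `c`, then `K` collapses to the subcomplex of the
simplices without the face `σ`. -/
theorem collapses_deleteFace [Finite V] (K : PreAbstractSimplicialComplex V) {σ : Finset V} {c : V}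
    (hσ : σ.Nonempty) (hc : c ∉ σ) (h : ∀ s ∈ K.faces, σ ⊆ s → insert c s ∈ K.faces) :
    Relation.ReflTransGen ElementarySimplicialCollapse K (deleteFace K σ) := by
  induction hn : {s | s ∈ K.faces ∧ σ ⊆ s}.ncard using Nat.strong_induction_on generalizing K with
  | _ n ih =>
    have herase {s} (hs : s ∈ K.faces) (hσs : σ ⊆ s) :
        s.erase c ∈ {s | s ∈ K.faces ∧ σ ⊆ s ∧ c ∉ s} := by
      have hσs' : σ ⊆ s.erase c := Finset.subset_erase.2 ⟨hσs, hc⟩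
      exact ⟨(K.isRelLowerSet_faces hs).2 (Finset.erase_subset _ _) (hσ.mono hσs'), hσs',
        Finset.notMem_erase _ _⟩
    by_cases hex : ∃ s ∈ K.faces, σ ⊆ s
    · obtain ⟨s, hs, hσs⟩ := hex
      -- By maximality, `S` and `insert c S` are the only faces containing `S`, so `S` is a free
      -- face.
      obtain ⟨S, ⟨hSK, hσS, hcS⟩, hmax⟩ :=
        (Set.toFinite {s | s ∈ K.faces ∧ σ ⊆ s ∧ c ∉ s}).exists_maximal ⟨_, herase hs hσs⟩
      have hle {t} (ht : t ∈ K.faces) (hSt : S ⊆ t) : t ⊆ insert c S := by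
        have h1 := herase ht (hσS.trans hSt)
        exact Finset.subset_insert_iff.2
          (hmax h1 (Finset.subset_erase.2 ⟨hSt, hcS⟩))
      refine .head (elementarySimplicialCollapse_deleteFace K (hσ.mono hσS) hcS (h S hSK hσS)
        fun t => hle) ?_
      have heq : deleteFace K σ = deleteFace (deleteFace K S) σ := by
        ext t
        exact ⟨fun ht => ⟨⟨ht.1, fun hSt => ht.2 (hσS.trans hSt)⟩, ht.2⟩,
          fun ht => ⟨ht.1.1, ht.2⟩⟩
      rw [heq]
      -- The cone condition survives the deletion of `S`: since `c ∉ S`, inserting `c` into `t`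
      -- cannot create the face `S`.
      refine ih _ ?_ (deleteFace K S) (fun t ht hσt => ⟨h t ht.1 hσt, fun hSt => ht.2 ?_⟩) rfl
      · rw [← hn]
        refine Set.ncard_lt_ncard ⟨fun t ht => ⟨ht.1.1, ht.2⟩, fun hsub => ?_⟩ (Set.toFinite _)
        exact (hsub ⟨hSK, hσS⟩).1.2 subset_rfl
      · exact (Finset.subset_insert_iff_of_notMem hcS).1 hSt
    · have heq : deleteFace K σ = K := by
        ext t
        exact ⟨fun ht => ht.1, fun ht => ⟨ht, fun hσt => hex ⟨t, ht, hσt⟩⟩⟩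
      rw [heq]

end Collapses

/-! ### Removing a point from a complex of chains -/

section Chains

variable {X : Type u} [TopologicalSpace X]

/-- The complex of the nonempty chains contained in `A`. -/
def chainComplex (A : Set X) : PreAbstractSimplicialComplex X where
  faces := {s | s.Nonempty ∧ (∀ a ∈ s, a ∈ A) ∧ ∀ a ∈ s, ∀ b ∈ s, Comparable a b}
  isRelLowerSet_faces _ hs := ⟨hs.1, fun _ ht hn =>
    ⟨hn, fun a ha => hs.2.1 a (ht ha), fun a ha b hb => hs.2.2 a (ht ha) b (ht hb)⟩⟩

theorem Comparable.symm {a b : X} (h : Comparable a b) : Comparable b a := Or.symm h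

theorem comparable_refl (a : X) : Comparable a a := .inl specializes_rfl

theorem deleteFace_chainComplex (A : Set X) (x : X) :
    deleteFace (chainComplex A) {x} = chainComplex (A \ {x}) := by
  ext s
  simp only [deleteFace, chainComplex, Finset.singleton_subset_iff]
  constructor
  · rintro ⟨⟨h1, h2, h3⟩, h4⟩
    exact ⟨h1, fun a ha => ⟨h2 a ha, fun hax => h4 (hax ▸ ha)⟩, h3⟩
  · rintro ⟨h1, h2, h3⟩
    exact ⟨⟨h1, fun a ha => (h2 a ha).1, h3⟩, fun hx => (h2 x hx).2 rfl⟩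

open Classical in
theorem insert_mem_chainComplex {A : Set X} {s : Finset X} {c : X}
    (hs : s ∈ (chainComplex A).faces) (hc : c ∈ A) (h : ∀ d ∈ s, Comparable d c) :
    insert c s ∈ (chainComplex A).faces := by
  refine ⟨Finset.insert_nonempty _ _, fun a ha => ?_, fun a ha b hb => ?_⟩
  · rcases Finset.mem_insert.1 ha with rfl | ha
    · exact hc
    · exact hs.2.1 a ha
  · rcases Finset.mem_insert.1 ha with rfl | ha' <;> rcases Finset.mem_insert.1 hb with rfl | hb'
    · exact comparable_refl _
    · exact (h b hb').symm
    · exact h a ha'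
    · exact hs.2.2 a ha' b hb'

/-- Removing a dominated point from a finite space is a collapse of the chain complexes. -/
theorem chainComplex_collapses_of_dominated [Finite X] {A : Set X} {x c : X} (hc : c ∈ A)
    (hne : c ≠ x) (h : ∀ d ∈ A, Comparable d x → Comparable d c) :
    Relation.ReflTransGen ElementarySimplicialCollapse (chainComplex A)
      (chainComplex (A \ {x})) := by
  rw [← deleteFace_chainComplex]
  refine collapses_deleteFace _ (c := c) (Finset.singleton_nonempty x) (by simpa) fun s hs hx => ?_
  exact insert_mem_chainComplex hs hc fun d hd =>
    h d (hs.2.1 d hd) (hs.2.2 d hd x (Finset.singleton_subset_iff.1 hx))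

/-- The chains contained in `A` which, if they contain `x`, meet the points below `x` only in
`B`. -/
def restrictBelow (A : Set X) (x : X) (B : Set X) : PreAbstractSimplicialComplex X where
  faces := {s | s ∈ (chainComplex A).faces ∧ (x ∈ s → ∀ b ∈ s, b ⤳ x → b ≠ x → b ∈ B)}
  isRelLowerSet_faces _ hs := ⟨hs.1.1, fun _ ht hn =>
    ⟨((chainComplex A).isRelLowerSet_faces hs.1).2 ht hn,
      fun hx b hb => hs.2 (ht hx) b (ht hb)⟩⟩

-- Only the members of `s` in `B` need checking: the others are `x` or lie above `x`, hence above
-- `c`.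
open Classical in
theorem insert_mem_restrictBelow {A B : Set X} {s : Finset X} {x c : X} (hx : x ∈ s)
    (hs : s ∈ (restrictBelow A x B).faces) (hcA : c ∈ A) (hc : c ∈ B) (hcx : c ⤳ x)
    (h : ∀ d ∈ s, d ∈ B → Comparable d c) : insert c s ∈ (restrictBelow A x B).faces := by
  refine ⟨insert_mem_chainComplex hs.1 hcA fun d hd => ?_, fun _ b hb hbx hne => ?_⟩
  · rcases hs.1.2.2 d hd x hx with h' | h'
    · by_cases hdx : d = x
      · exact .inr (hdx ▸ hcx)
      · exact h d hd (hs.2 hx d hd h' hdx)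
    · exact .inr (hcx.trans h')
  · rcases Finset.mem_insert.1 hb with rfl | hb
    · exact hc
    · exact hs.2 hx b hb hbx hne

/-- Dismantling `B` is mirrored by collapses. If `c` dominates `b` in `B`, the link of the edge `{x,
b}` is a cone with apex `c`, so that edge can be deleted, which replaces `B` by `B \ {b}`. Once `B =
{m}`, the link of `x` is a cone with apex `m`, and `x` itself can be deleted. -/
theorem restrictBelow_collapses [Finite X] {A B : Set X} {x : X} (hB : Dismantlable B)
    (h : ∀ b ∈ B, b ∈ A ∧ b ⤳ x ∧ b ≠ x) :
    Relation.ReflTransGen ElementarySimplicialCollapse (restrictBelow A x B)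
      (chainComplex (A \ {x})) := by
  classical
  induction hB with
  | point m =>
    obtain ⟨hmA, hmx, hne⟩ := h m rfl
    have heq : chainComplex (A \ {x}) = deleteFace (restrictBelow A x {m}) {x} := by
      rw [← deleteFace_chainComplex]
      ext s
      simp only [deleteFace, restrictBelow, Finset.singleton_subset_iff]
      exact ⟨fun hs => ⟨⟨hs.1, fun hx => (hs.2 hx).elim⟩, hs.2⟩, fun hs => ⟨hs.1.1, hs.2⟩⟩
    rw [heq]
    refine collapses_deleteFace _ (c := m) (Finset.singleton_nonempty x) (by simpa)
      fun s hs hx => insert_mem_restrictBelow (Finset.singleton_subset_iff.1 hx) hs hmA rfl hmx ?_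
    rintro d - rfl
    exact comparable_refl _
  | @step B b c hb hc hne hdom _ ih =>
    obtain ⟨hbA, hbx, hbne⟩ := h b hb
    obtain ⟨hcA, hcx, hcne⟩ := h c hc
    refine Relation.ReflTransGen.trans ?_ (ih fun d hd => h d hd.1)
    have heq : restrictBelow A x (B \ {b}) = deleteFace (restrictBelow A x B) {x, b} := by
      ext s
      simp only [deleteFace, restrictBelow, Finset.insert_subset_iff, Finset.singleton_subset_iff]
      constructor
      · rintro ⟨h1, h2⟩
        exact ⟨⟨h1, fun hx d hd hdx hdne => (h2 hx d hd hdx hdne).1⟩,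
          fun h3 => (h2 h3.1 b h3.2 hbx hbne).2 rfl⟩
      · rintro ⟨⟨h1, h2⟩, h3⟩
        exact ⟨h1, fun hx d hd hdx hdne => ⟨h2 hx d hd hdx hdne, fun hdb => h3 ⟨hx, hdb ▸ hd⟩⟩⟩
    rw [heq]
    refine collapses_deleteFace _ (c := c) (Finset.insert_nonempty _ _) (by simp [hne, hcne])
      fun s hs hsub => ?_
    rw [Finset.insert_subset_iff, Finset.singleton_subset_iff] at hsub
    exact insert_mem_restrictBelow hsub.1 hs hcA hc hcx fun d hd hdB =>
      hdom d hdB (hs.1.2.2 d hd b hsub.2)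

/-- If the points of `A` strictly below `x` form a dismantlable set, removing `x` from `A` is a
collapse of the chain complexes. -/
theorem chainComplex_collapses_of_dismantlable [Finite X] {A : Set X} {x : X}
    (h : Dismantlable {b | b ∈ A ∧ b ⤳ x ∧ b ≠ x}) :
    Relation.ReflTransGen ElementarySimplicialCollapse (chainComplex A)
      (chainComplex (A \ {x})) := by
  have heq : chainComplex A = restrictBelow A x {b | b ∈ A ∧ b ⤳ x ∧ b ≠ x} := by
    ext s
    exact ⟨fun hs => ⟨hs, fun _ b hb hbx hne => ⟨hs.2.1 b hb, hbx, hne⟩⟩, fun hs => hs.1⟩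
  rw [heq]
  exact restrictBelow_collapses h fun b hb => hb

end Chains

/-! ### Calculus of homotopy inverses -/

section HomotopyInverse

variable {A B C : Type u} [TopologicalSpace A] [TopologicalSpace B] [TopologicalSpace C]

theorem IsHomotopyInverse.symm {g : C(B, A)} {f : C(A, B)} (h : IsHomotopyInverse g f) :
    IsHomotopyInverse f g :=
  ⟨h.2, h.1⟩

theorem IsHomotopyInverse.comp {g : C(B, A)} {f : C(A, B)} {g' : C(C, B)} {f' : C(B, C)}
    (h : IsHomotopyInverse g f) (h' : IsHomotopyInverse g' f') :
    IsHomotopyInverse (g.comp g') (f'.comp f) :=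
  let e := (ContinuousMap.HomotopyEquiv.mk f g h.1 h.2).trans
    (ContinuousMap.HomotopyEquiv.mk f' g' h'.1 h'.2)
  ⟨e.left_inv, e.right_inv⟩

theorem IsHomotopyInverse.of_eq {g : C(B, A)} {f : C(A, B)} (h : ∀ a, g (f a) = a)
    (h' : ∀ b, f (g b) = b) : IsHomotopyInverse g f := by
  have h1 : g.comp f = ContinuousMap.id A := ContinuousMap.ext h
  have h2 : f.comp g = ContinuousMap.id B := ContinuousMap.ext h'
  exact ⟨h1 ▸ .refl _, h2 ▸ .refl _⟩

end HomotopyInverse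

/-! ### Collapses are homotopy equivalences of polyhedra -/

section Polyhedron

variable {V : Type u} [Fintype V]

/-- The polyhedron of a complex which need not contain all vertices. -/
def Polyhedron (K : PreAbstractSimplicialComplex V) : Type u :=
  {p : stdSimplex ℝ V // ∃ s ∈ K.faces, ∀ v, p v ≠ 0 → v ∈ s}

instance (K : PreAbstractSimplicialComplex V) : TopologicalSpace (Polyhedron K) :=
  inferInstanceAs (TopologicalSpace {_p : stdSimplex ℝ V // _})

theorem Polyhedron.ext {K : PreAbstractSimplicialComplex V} {p q : Polyhedron K}
    (h : ∀ v, p.1 v = q.1 v) : p = q :=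
  Subtype.ext (stdSimplex.ext (funext h))

theorem Polyhedron.continuous_apply (K : PreAbstractSimplicialComplex V) (v : V) :
    Continuous fun p : Polyhedron K => p.1 v :=
  (_root_.continuous_apply v).comp (continuous_subtype_val.comp continuous_subtype_val)

theorem Polyhedron.continuous_mk {A : Type*} [TopologicalSpace A]
    (K : PreAbstractSimplicialComplex V) (f : A → Polyhedron K)
    (h : ∀ v, Continuous fun a => (f a).1 v) : Continuous f :=
  ((continuous_pi h).subtype_mk fun a => (f a).1.2).subtype_mk fun a => (f a).2

/-- The support of a point of the standard simplex. -/
def supp (p : stdSimplex ℝ V) : Finset V := by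
  classical exact {v | p v ≠ 0}

theorem mem_supp {p : stdSimplex ℝ V} {v : V} : v ∈ supp p ↔ p v ≠ 0 := by
  simp [supp]

theorem supp_nonempty (p : stdSimplex ℝ V) : (supp p).Nonempty := by
  obtain ⟨v, -, hv⟩ := Finset.exists_ne_zero_of_sum_ne_zero
    (s := Finset.univ) (f := p) (by simp)
  exact ⟨v, mem_supp.2 hv⟩

theorem Polyhedron.supp_mem {K : PreAbstractSimplicialComplex V} (p : Polyhedron K) :
    supp p.1 ∈ K.faces := by
  obtain ⟨s, hs, hp⟩ := p.2
  exact (K.isRelLowerSet_faces hs).2 (fun v hv => hp v (mem_supp.1 hv)) (supp_nonempty _)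

/-- Two maps into a polyhedron are homotopic if for each point its images lie in a common
simplex. -/
theorem homotopic_of_common_simplex {A : Type u} [TopologicalSpace A]
    {K : PreAbstractSimplicialComplex V} (F G : C(A, Polyhedron K))
    (h : ∀ a, ∃ s ∈ K.faces, ∀ v, (F a).1 v ≠ 0 ∨ (G a).1 v ≠ 0 → v ∈ s) : F.Homotopic G := by
  let H (x : unitInterval × A) : Polyhedron K :=
    ⟨⟨fun v => (1 - (x.1 : ℝ)) * (F x.2).1 v + x.1 * (G x.2).1 v,
      convex_stdSimplex ℝ V (F x.2).1.2 (G x.2).1.2 (sub_nonneg.2 x.1.2.2) x.1.2.1 (by ring)⟩, by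
      obtain ⟨s, hs, hv⟩ := h x.2
      refine ⟨s, hs, fun v hne => hv v ?_⟩
      by_contra! h0
      refine hne ?_
      change (1 - (x.1 : ℝ)) * (F x.2).1 v + x.1 * (G x.2).1 v = 0
      rw [h0.1, h0.2]
      ring⟩
  refine ⟨⟨⟨H, Polyhedron.continuous_mk K _ fun v => ?_⟩, fun a => ?_, fun a => ?_⟩⟩
  · have h1 := (Polyhedron.continuous_apply K v).comp F.continuous
    have h2 := (Polyhedron.continuous_apply K v).comp G.continuous
    have h3 : Continuous fun x : unitInterval × A => (x.1 : ℝ) :=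
      continuous_subtype_val.comp continuous_fst
    exact ((continuous_const.sub h3).mul (h1.comp continuous_snd)).add
      (h3.mul (h2.comp continuous_snd))
  · refine Polyhedron.ext fun v => ?_
    change (1 - (0 : ℝ)) * (F a).1 v + 0 * (G a).1 v = _
    ring
  · refine Polyhedron.ext fun v => ?_
    change (1 - (1 : ℝ)) * (F a).1 v + 1 * (G a).1 v = _
    ring

/-- The inclusion of the polyhedron of a subcomplex. -/
def Polyhedron.incl {L K : PreAbstractSimplicialComplex V} (h : L.faces ⊆ K.faces) :
    C(Polyhedron L, Polyhedron K) where
  toFun p := ⟨p.1, p.2.imp fun _ hs => ⟨h hs.1, hs.2⟩⟩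
  continuous_toFun := Polyhedron.continuous_mk K _ (Polyhedron.continuous_apply L)

open Classical in
/-- Push `p` away from the simplex `S` in the direction of `a`, until a coordinate vanishes. -/
def pushOff {S : Finset V} (hS : S.Nonempty) (a : V) (p : stdSimplex ℝ V) : stdSimplex ℝ V :=
  -- The least coordinate on `S` is subtracted all over `S`; the total removed goes to `a`, so the
  -- sum stays 1.
  ⟨fun v => p v - (if v ∈ S then S.inf' hS p else 0) +
      (if v = a then S.card * S.inf' hS p else 0), by
    constructor
    · intro v
      have h0 : 0 ≤ S.inf' hS p := Finset.le_inf' _ _ fun v _ => stdSimplex.zero_le p v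
      have h1 : 0 ≤ if v = a then (S.card : ℝ) * S.inf' hS p else 0 := by
        split_ifs <;> positivity
      have h2 : (if v ∈ S then S.inf' hS p else 0) ≤ p v := by
        split_ifs with hv
        · exact Finset.inf'_le _ hv
        · exact stdSimplex.zero_le p v
      linarith
    · simp [Finset.sum_add_distrib, Finset.sum_sub_distrib, Finset.sum_ite_mem]⟩

open Classical in
theorem pushOff_apply {S : Finset V} (hS : S.Nonempty) (a : V) (p : stdSimplex ℝ V) (v : V) :
    pushOff hS a p v = p v - (if v ∈ S then S.inf' hS p else 0) +
      (if v = a then S.card * S.inf' hS p else 0) :=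
  rfl

/-- Some coordinate on `S` is already zero, so the minimum to be subtracted is zero. -/
theorem pushOff_eq_self {S : Finset V} (hS : S.Nonempty) (a : V) {p : stdSimplex ℝ V}
    (h : ¬ S ⊆ supp p) : pushOff hS a p = p := by
  obtain ⟨w, hw, hwp⟩ := Finset.not_subset.1 h
  have h0 : S.inf' hS p = 0 := le_antisymm
    ((Finset.inf'_le _ hw).trans (not_not.1 (mt mem_supp.2 hwp)).le)
    (Finset.le_inf' _ _ fun v _ => stdSimplex.zero_le p v)
  refine stdSimplex.ext (funext fun v => ?_)
  simp [pushOff_apply, h0]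

open Classical in
theorem mem_of_pushOff_ne_zero {S : Finset V} (hS : S.Nonempty) {a : V} {p : stdSimplex ℝ V}
    {v : V} (hp : supp p ⊆ insert a S) (hv : pushOff hS a p v ≠ 0) : v ∈ insert a S := by
  by_contra hn
  refine hv ?_
  rw [pushOff_apply, not_not.1 (mt mem_supp.2 (mt (@hp v) hn))]
  rw [Finset.mem_insert, not_or] at hn
  simp [hn]

theorem continuous_pushOff_apply {S : Finset V} (hS : S.Nonempty) (a v : V) :
    Continuous fun p : stdSimplex ℝ V => pushOff hS a p v := by
  have h (v : V) : Continuous fun p : stdSimplex ℝ V => p v :=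
    (continuous_apply v).comp continuous_subtype_val
  have hm : Continuous fun p : stdSimplex ℝ V => S.inf' hS p :=
    Continuous.finset_inf'_apply hS fun v _ => h v
  simp only [pushOff_apply]
  refine ((h v).sub ?_).add ?_
  · split_ifs
    · exact hm
    · exact continuous_const
  · split_ifs
    · exact continuous_const.mul hm
    · exact continuous_const

open Classical in
/-- The inclusion given by an elementary collapse is a homotopy equivalence. -/
theorem ElementarySimplicialCollapse.isHomotopyInverse {K L : PreAbstractSimplicialComplex V}
    (h : ElementarySimplicialCollapse K L) :
    ∃ (hLK : L.faces ⊆ K.faces) (g : C(Polyhedron K, Polyhedron L)),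
      IsHomotopyInverse g (Polyhedron.incl hLK) := by
  obtain ⟨S, a, hS, ha, hK, hL⟩ := h
  have hK' (t) : t ∈ K.faces ↔ t ∈ L.faces ∨ t.Nonempty ∧ t ⊆ insert a S := by
    rw [hK]; exact Iff.rfl
  have hL' (t) : t ∈ L.faces ∧ t.Nonempty ∧ t ⊆ insert a S ↔
      t.Nonempty ∧ t ⊆ insert a S ∧ ¬ S ⊆ t := by
    change t ∈ (L ⊓ fullSimplex (insert a S)).faces ↔ _
    rw [hL]; exact Iff.rfl
  have hLK : L.faces ⊆ K.faces := fun t ht => (hK' t).2 (.inl ht)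
  -- Otherwise `S` would lie in `L ∩ aS = a ∂S`, which excludes it.
  have hSL {t} (ht : t ∈ L.faces) : ¬ S ⊆ t := fun hSt =>
    ((hL' S).1 ⟨(L.isRelLowerSet_faces ht).2 hSt hS, hS, Finset.subset_insert _ _⟩).2.2 subset_rfl
  have hsub (p : Polyhedron K) (hp : S ⊆ supp p.1) : supp p.1 ⊆ insert a S := by
    rcases (hK' _).1 p.supp_mem with h | h
    · exact (hSL h hp).elim
    · exact h.2
  let r : C(Polyhedron K, Polyhedron L) :=
    { toFun p := ⟨pushOff hS a p.1, by
        by_cases hp : S ⊆ supp p.1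
        -- The minimum is attained at `w`, whose coordinate becomes zero; the image lies in the face
        -- of `aS` opposite `w`, a simplex of `a ∂S`.
        · obtain ⟨w, hw, hwm⟩ := Finset.exists_mem_eq_inf' hS p.1
          have hwa : w ≠ a := fun h => ha (h ▸ hw)
          refine ⟨(insert a S).erase w, ((hL' _).2 ⟨⟨a, ?_⟩, Finset.erase_subset _ _, ?_⟩).1,
            fun v hv => Finset.mem_erase.2 ⟨?_, mem_of_pushOff_ne_zero hS (hsub p hp) hv⟩⟩
          · simp [hwa.symm]
          · exact fun h => Finset.notMem_erase w _ (h hw)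
          · rintro rfl
            refine hv ?_
            simp [pushOff_apply, hw, hwa, hwm]
        · rw [pushOff_eq_self hS a hp]
          refine ⟨supp p.1, ?_, fun v => mem_supp.2⟩
          rcases (hK' _).1 p.supp_mem with h | h
          · exact h
          · exact ((hL' _).2 ⟨h.1, h.2, hp⟩).1⟩
      continuous_toFun := Polyhedron.continuous_mk L _ fun v =>
        (continuous_pushOff_apply hS a v).comp continuous_subtype_val }
  refine ⟨hLK, r, ?_, ?_⟩
  · have h1 : r.comp (Polyhedron.incl hLK) = ContinuousMap.id _ :=
      ContinuousMap.ext fun p => Subtype.ext (pushOff_eq_self hS a (hSL p.supp_mem))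
    exact h1 ▸ .refl _
  -- A moved point and its image both lie in `aS`; all other points are fixed.
  · refine homotopic_of_common_simplex _ _ fun p => ?_
    by_cases hp : S ⊆ supp p.1
    · refine ⟨insert a S, (hK' _).2 (.inr ⟨Finset.insert_nonempty _ _, subset_rfl⟩), fun v hv => ?_⟩
      rcases hv with hv | hv
      · exact mem_of_pushOff_ne_zero hS (hsub p hp) hv
      · exact hsub p hp (mem_supp.2 hv)
    · refine ⟨supp p.1, p.supp_mem, fun v hv => mem_supp.2 ?_⟩
      rcases hv with hv | hv
      · change pushOff hS a p.1 v ≠ 0 at hv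
        rwa [pushOff_eq_self hS a hp] at hv
      · exact hv

/-- The inclusion given by a sequence of collapses is a homotopy equivalence. -/
theorem isHomotopyInverse_of_collapses {K L : PreAbstractSimplicialComplex V}
    (h : Relation.ReflTransGen ElementarySimplicialCollapse K L) :
    ∃ (hLK : L.faces ⊆ K.faces) (g : C(Polyhedron K, Polyhedron L)),
      IsHomotopyInverse g (Polyhedron.incl hLK) := by
  induction h with
  | refl => exact ⟨subset_rfl, .id _, .of_eq (fun _ => rfl) fun _ => rfl⟩
  | tail _ h ih =>
    obtain ⟨h1, g1, hg1⟩ := ih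
    obtain ⟨h2, g2, hg2⟩ := h.isHomotopyInverse
    exact ⟨h2.trans h1, g2.comp g1, hg2.comp hg1⟩

end Polyhedron

/-! ### Realizations of expansions -/

section Expansion

theorem map_apply_of_injective {V W : Type u} [Fintype V] [Fintype W] {φ : V → W}
    (hφ : Function.Injective φ) (p : stdSimplex ℝ V) (v : V) :
    stdSimplex.map φ p (φ v) = p v := by
  classical
  rw [stdSimplex.map_coe, FunOnFinite.linearMap_apply_apply, Finset.sum_filter]
  simp [hφ.eq_iff]

theorem map_apply_of_notMem_range {V W : Type u} [Fintype V] [Fintype W] {φ : V → W}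
    (p : stdSimplex ℝ V) {w : W} (hw : w ∉ Set.range φ) : stdSimplex.map φ p w = 0 := by
  classical
  rw [stdSimplex.map_coe, FunOnFinite.linearMap_apply_apply]
  exact Finset.sum_eq_zero fun v hv => (hw ⟨v, (Finset.mem_filter.1 hv).2⟩).elim

open Classical in
/-- The realization of an expansion is a homotopy equivalence. -/
theorem SimplicialMap.IsExpansion.isHomotopyInverse {L K : FinComplex.{u}}
    {φ : SimplicialMap L K} (h : φ.IsExpansion) :
    ∃ g : C(K.Realization, L.Realization), IsHomotopyInverse g φ.realize := by
  obtain ⟨hφ, hcol⟩ := h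
  obtain ⟨hLK, g, hg⟩ := isHomotopyInverse_of_collapses hcol
  have hrange {w : K.Vertex}
      (q : Polyhedron (L.cplx.toPreAbstractSimplicialComplex.map φ.toFun))
      (hw : w ∉ Set.range φ.toFun) : q.1 w = 0 := by
    obtain ⟨_, ⟨s, hs, rfl⟩, hq⟩ := q.2
    by_contra h0
    obtain ⟨v, -, rfl⟩ := Finset.mem_image.1 (hq w h0)
    exact hw ⟨v, rfl⟩
  -- The realization of `φ` factors through the polyhedron of its image: `fwd` is a homeomorphism
  -- with inverse `back`, and the inclusion that follows is the one treated by `hcol`.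
  let fwd : C(L.Realization,
      Polyhedron (L.cplx.toPreAbstractSimplicialComplex.map φ.toFun)) :=
    { toFun p := ⟨stdSimplex.map φ.toFun p.1, by
        obtain ⟨s, hs, hp⟩ := p.2
        refine ⟨_, ⟨s, hs, rfl⟩, fun w hw => ?_⟩
        by_cases hw' : w ∈ Set.range φ.toFun
        · obtain ⟨v, rfl⟩ := hw'
          rw [map_apply_of_injective hφ] at hw
          exact Finset.mem_image_of_mem _ (hp v hw)
        · exact (hw (map_apply_of_notMem_range _ hw')).elim⟩
      continuous_toFun := Polyhedron.continuous_mk _ _ fun w =>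
        (continuous_apply w).comp (continuous_subtype_val.comp
          ((stdSimplex.continuous_map φ.toFun).comp continuous_subtype_val)) }
  let back : C(Polyhedron (L.cplx.toPreAbstractSimplicialComplex.map φ.toFun),
      L.Realization) :=
    { toFun q := ⟨⟨fun v => q.1 (φ.toFun v), fun v => stdSimplex.zero_le q.1 _, by
          rw [← stdSimplex.sum_eq_one q.1]
          exact Fintype.sum_of_injective φ.toFun hφ _ _ (fun w hw => hrange q hw) fun _ => rfl⟩, by
        obtain ⟨_, ⟨s, hs, rfl⟩, hq⟩ := q.2
        refine ⟨s, hs, fun v hv => ?_⟩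
        obtain ⟨v', hv', h⟩ := Finset.mem_image.1 (hq _ hv)
        exact hφ h ▸ hv'⟩
      continuous_toFun :=
        Polyhedron.continuous_mk L.cplx.toPreAbstractSimplicialComplex _ fun v =>
          Polyhedron.continuous_apply _ (φ.toFun v) }
  have h1 : IsHomotopyInverse back fwd := by
    refine .of_eq (fun p => ?_) fun q => ?_
    · exact Polyhedron.ext (K := L.cplx.toPreAbstractSimplicialComplex) fun v =>
        map_apply_of_injective hφ p.1 v
    · refine Polyhedron.ext fun w => ?_
      by_cases hw : w ∈ Set.range φ.toFun
      · obtain ⟨v, rfl⟩ := hw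
        exact map_apply_of_injective hφ _ v
      · exact (map_apply_of_notMem_range _ hw).trans (hrange q hw).symm
  exact ⟨back.comp g, h1.comp hg⟩

end Expansion

/-! ### Weak points, embeddings and induction on finite spaces -/

section WeakPoints

variable {X : Type u} [TopologicalSpace X]

/-- A space with a point that belongs to every nonempty open set is contractible. -/
theorem contractibleSpace_of_forall_specializes (c : X) (h : ∀ d, c ⤳ d) :
    ContractibleSpace X := by
  classical
  rw [contractible_iff_id_nullhomotopic]
  -- The homotopy jumps to `c` at every positive time; this is continuous because `c` lies in each
  -- nonempty open set.
  refine ⟨c, ⟨⟨⟨fun p => if p.1 = 0 then p.2 else c, ⟨fun s hs => ?_⟩⟩, fun x => if_pos rfl,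
    fun x => if_neg one_ne_zero⟩⟩⟩
  rcases s.eq_empty_or_nonempty with rfl | ⟨d, hd⟩
  · exact isOpen_empty
  have hc : c ∈ s := (h d).mem_open hs hd
  have heq : (fun p : unitInterval × X => if p.1 = 0 then p.2 else c) ⁻¹' s =
      Prod.fst ⁻¹' {0}ᶜ ∪ Prod.snd ⁻¹' s := by
    ext p
    by_cases hp : p.1 = 0 <;> simp [hp, hc]
  rw [heq]
  exact (isOpen_compl_singleton.preimage continuous_fst).union (hs.preimage continuous_snd)

theorem isWeakPoint_of_below {A : Set X} (x : A)
    (h : ContractibleSpace {b | b ∈ A ∧ b ⤳ (x : X) ∧ b ≠ x}) : IsWeakPoint x := by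
  left
  have heq : Subtype.val '' (minOpen x \ {x}) = {b | b ∈ A ∧ b ⤳ (x : X) ∧ b ≠ x} := by
    ext b
    constructor
    · rintro ⟨b, ⟨hb, hne⟩, rfl⟩
      exact ⟨b.2, (subtype_specializes_iff _ _).1 (mem_minOpen_iff.1 hb),
        fun h => hne (Subtype.ext h)⟩
    · rintro ⟨hb, hbx, hne⟩
      exact ⟨⟨b, hb⟩, ⟨mem_minOpen_iff.2 ((subtype_specializes_iff _ _).2 hbx),
        fun h => hne (congrArg Subtype.val h)⟩, rfl⟩
  rw [← heq] at h
  exact (IsEmbedding.subtypeVal.homeomorphImage _).contractibleSpace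

theorem isWeakPoint_of_above {A : Set X} (x : A)
    (h : ContractibleSpace {b | b ∈ A ∧ (x : X) ⤳ b ∧ b ≠ x}) : IsWeakPoint x := by
  right
  have heq : Subtype.val '' (closure {x} \ {x}) = {b | b ∈ A ∧ (x : X) ⤳ b ∧ b ≠ x} := by
    ext b
    constructor
    · rintro ⟨b, ⟨hb, hne⟩, rfl⟩
      exact ⟨b.2, (subtype_specializes_iff _ _).1 (specializes_iff_mem_closure.2 hb),
        fun h => hne (Subtype.ext h)⟩
    · rintro ⟨hb, hbx, hne⟩
      exact ⟨⟨b, hb⟩, ⟨specializes_iff_mem_closure.1 ((subtype_specializes_iff _ _).2 hbx),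
        fun h => hne (congrArg Subtype.val h)⟩, rfl⟩
  rw [← heq] at h
  exact (IsEmbedding.subtypeVal.homeomorphImage _).contractibleSpace

/-- A finite topology is determined by its specialization order: an open set of `A` is the preimage
of the smallest open set containing its image. -/
theorem isEmbedding_of_specializes_iff {A B : Type*} [TopologicalSpace A] [TopologicalSpace B]
    [Finite A] [T0Space A] [Finite B] {g : A → B} (h : ∀ a b, g a ⤳ g b ↔ a ⤳ b) :
    IsEmbedding g := by
  refine IsInducing.isEmbedding ⟨le_antisymm ?_ ?_⟩
  · exact (continuous_of_specializes fun a b => (h a b).2).le_induced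
  · intro s hs
    refine isOpen_induced_iff.2 ⟨nhdsKer (g '' s), isOpen_nhdsKer, ?_⟩
    refine Set.Subset.antisymm (fun a ha => ?_) fun a ha => subset_nhdsKer ⟨a, ha, rfl⟩
    obtain ⟨_, ⟨b, hb, rfl⟩, hab⟩ := mem_nhdsKer_iff_specializes.1 ha
    exact ((h a b).1 hab).mem_open hs hb

/-- To reach the whole of a type it suffices to be able to add a point once all its predecessors
have been added. -/
theorem univ_of_insert {Y : Type*} [Finite Y] {r : Y → Y → Prop} (hr : WellFounded r)
    {P : Set Y → Prop} (h0 : P ∅)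
    (hs : ∀ D y, y ∉ D → (∀ z, r z y → z ∈ D) → P D → P (insert y D)) : P Set.univ := by
  obtain ⟨D, hD, hmax⟩ := (Set.toFinite {D | P D}).exists_maximal ⟨∅, h0⟩
  by_cases hne : (Dᶜ).Nonempty
  · have hy := hr.min_mem _ hne
    have hz (z) (hzy : r z (hr.min _ hne)) : z ∈ D := by
      by_contra hzD
      exact hr.not_lt_min _ hzD hzy
    exact (hy (hmax (hs D _ hy hz hD) (Set.subset_insert _ _) (Set.mem_insert _ _))).elim
  · rw [Set.not_nonempty_iff_eq_empty, Set.compl_empty_iff] at hne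
    exact hne ▸ hD

end WeakPoints

/-! ### Functoriality of the order complex -/

section OrderComplex

variable {X Y Z : Type u} [TopologicalSpace X] [TopologicalSpace Y] [TopologicalSpace Z]
  [Fintype X] [Fintype Y] [Fintype Z]

theorem isChain_iff_comparable {X : Type u} [TopologicalSpace X] {s : Set X} :
    IsChain (fun a b => a ∈ minOpen b) s ↔ ∀ a ∈ s, ∀ b ∈ s, Comparable a b := by
  constructor
  · intro h a ha b hb
    by_cases hab : a = b
    · exact hab ▸ comparable_refl a
    · exact (h ha hb hab).imp mem_minOpen_iff.1 mem_minOpen_iff.1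
  · intro h a ha b hb _
    exact (h a ha b hb).imp mem_minOpen_iff.2 mem_minOpen_iff.2

theorem mem_faces_orderComplex {s : Finset X} :
    s ∈ (orderComplex X).cplx.faces ↔ s.Nonempty ∧ ∀ a ∈ s, ∀ b ∈ s, Comparable a b :=
  and_congr_right fun _ => isChain_iff_comparable

theorem orderComplex_eq_chainComplex :
    (orderComplex X).cplx.toPreAbstractSimplicialComplex = chainComplex (Set.univ : Set X) := by
  ext s
  exact mem_faces_orderComplex.trans
    ⟨fun h => ⟨h.1, fun _ _ => trivial, h.2⟩, fun h => ⟨h.1, h.2.2⟩⟩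

open Classical in
theorem map_chainComplex_univ {X Z : Type u} [TopologicalSpace X] [TopologicalSpace Z]
    {g : X → Z} (hg : IsEmbedding g) :
    (chainComplex (Set.univ : Set X)).map g = chainComplex (Set.range g) := by
  have hcomp {a b : X} : Comparable (g a) (g b) ↔ Comparable a b :=
    or_congr hg.isInducing.specializes_iff hg.isInducing.specializes_iff
  ext s
  change (∃ t, t ∈ (chainComplex (Set.univ : Set X)).faces ∧ t.image g = s) ↔ _
  constructor
  · rintro ⟨t, ⟨h1, -, h2⟩, rfl⟩
    refine ⟨h1.image g, fun a ha => ?_, fun a ha b hb => ?_⟩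
    · obtain ⟨a, -, rfl⟩ := Finset.mem_image.1 ha
      exact ⟨a, rfl⟩
    · obtain ⟨a, ha', rfl⟩ := Finset.mem_image.1 ha
      obtain ⟨b, hb', rfl⟩ := Finset.mem_image.1 hb
      exact hcomp.2 (h2 a ha' b hb')
  · rintro ⟨h1, h2, h3⟩
    obtain ⟨t, -, rfl⟩ := (Finset.subset_set_image_iff (s := Set.univ) (f := g) (t := s)).1
      (by rw [Set.image_univ]; exact h2)
    exact ⟨t, ⟨Finset.image_nonempty.1 h1, fun _ _ => trivial, fun a ha b hb =>
      hcomp.1 (h3 _ (Finset.mem_image_of_mem g ha) _ (Finset.mem_image_of_mem g hb))⟩, rfl⟩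

theorem isExpansion_orderComplexMap (g : C(X, Z)) (hg : IsEmbedding g)
    (h : Relation.ReflTransGen ElementarySimplicialCollapse (chainComplex (Set.univ : Set Z))
      (chainComplex (Set.range g))) : (orderComplexMap g).IsExpansion := by
  refine ⟨hg.injective, ?_⟩
  rw [← map_chainComplex_univ hg, ← orderComplex_eq_chainComplex (X := X),
    ← orderComplex_eq_chainComplex (X := Z)] at h
  exact h

theorem orderComplexMap_realize_comp (f : C(X, Y)) (g : C(Y, Z)) :
    (orderComplexMap g).realize.comp (orderComplexMap f).realize =
      (orderComplexMap (g.comp f)).realize :=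
  ContinuousMap.ext fun p => Subtype.ext (stdSimplex.map_comp_apply f g p.1)

theorem orderComplexMap_realize_id :
    (orderComplexMap (ContinuousMap.id X)).realize =
      ContinuousMap.id (orderComplex X).Realization :=
  ContinuousMap.ext fun p => Subtype.ext (stdSimplex.map_id_apply p.1)

/-- A retraction onto a homotopy equivalent subspace is a homotopy inverse of the inclusion. -/
theorem IsHomotopyInverse.of_comp_eq_id {A B : Type u} [TopologicalSpace A] [TopologicalSpace B]
    {f : C(A, B)} {g r : C(B, A)} (h : IsHomotopyInverse g f)
    (hr : r.comp f = ContinuousMap.id A) : IsHomotopyInverse r f := by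
  refine ⟨hr ▸ .refl _, ?_⟩
  -- The chain is `f r ≃ f r f g = f g ≃ id`.
  have h1 : ((f.comp r).comp (f.comp g)).Homotopic ((f.comp r).comp (ContinuousMap.id B)) :=
    (ContinuousMap.Homotopic.refl _).comp h.2
  have h2 : (f.comp r).comp (f.comp g) = f.comp g :=
    ContinuousMap.ext fun b => congrArg f (DFunLike.congr_fun hr (g b))
  rw [h2] at h1
  exact h1.symm.trans h.2

end OrderComplex

/-- The space `Z` collapses to `A`, and so does the complex of chains of `Z` to that of `A`. -/
def CollapsesTo {Z : Type u} [TopologicalSpace Z] (A : Set Z) : Prop :=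
  Relation.ReflTransGen ElementaryCollapse Set.univ A ∧
    Relation.ReflTransGen ElementarySimplicialCollapse (chainComplex Set.univ) (chainComplex A)

/-! ### Collapsing the cylinder onto its two ends -/

namespace Cylinder

variable {X Y : Type u} [TopologicalSpace X] [TopologicalSpace Y] (f : C(X, Y))

theorem specializes_iff_le {a b : Cylinder f} : a ⤳ b ↔ le f a b :=
  mem_minOpen_iff.symm.trans (mem_minOpen_iff_le f a b)

theorem inl_specializes_inl {a b : X} : inl f a ⤳ inl f b ↔ a ⤳ b :=
  (specializes_iff_le f).trans mem_minOpen_iff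

theorem inr_specializes_inr {a b : Y} : inr f a ⤳ inr f b ↔ a ⤳ b :=
  (specializes_iff_le f).trans mem_minOpen_iff

theorem inl_specializes_inr {a : X} {b : Y} : inl f a ⤳ inr f b ↔ f a ⤳ b :=
  (specializes_iff_le f).trans mem_minOpen_iff

theorem not_inr_specializes_inl {a : Y} {b : X} : ¬ inr f a ⤳ inl f b :=
  fun h => (specializes_iff_le f).1 h

theorem inl_injective : Function.Injective (inl f) := fun _ _ h => Sum.inl_injective h

theorem inr_injective : Function.Injective (inr f) := fun _ _ h => Sum.inr_injective h

theorem inl_ne_inr {a : X} {b : Y} : inl f a ≠ inr f b := Sum.inl_ne_inr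

variable {f} in
theorem ind {p : Cylinder f → Prop} (h1 : ∀ x, p (inl f x)) (h2 : ∀ y, p (inr f y)) (z) : p z :=
  Sum.rec h1 h2 z

variable [Finite X] [Finite Y]

/-- The points of `X` may be removed from the cylinder from top to bottom. -/
theorem collapsesTo_range_inr [T0Space X] : CollapsesTo (Set.range (inr f)) := by
  have key : CollapsesTo (inl f '' Set.univ)ᶜ := by
    -- `D` is the set of points already removed. For the swapped order, the predecessors of `x` are
    -- the points above it.
    refine univ_of_insert (P := fun D => CollapsesTo (inl f '' D)ᶜ)
      (wellFounded_specializes_swap (X := X)) ?_ fun D x hx hD ih => ?_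
    · simp only [Set.image_empty, Set.compl_empty]
      exact ⟨.refl, .refl⟩
    have hxA : inl f x ∈ (inl f '' D)ᶜ := by
      rwa [Set.mem_compl_iff, (inl_injective f).mem_set_image]
    have hcA : inr f (f x) ∈ (inl f '' D)ᶜ := by
      rintro ⟨_, _, h⟩
      exact inl_ne_inr f h
    have hins : (inl f '' insert x D)ᶜ = (inl f '' D)ᶜ \ {inl f x} := by
      rw [Set.image_insert_eq, Set.sdiff_eq, ← Set.compl_union, Set.insert_eq, Set.union_comm]
    have hxc : inl f x ⤳ inr f (f x) := (inl_specializes_inr f).2 specializes_rfl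
    -- The points of `X` above `x` are gone, so `f x` is the least of the points left strictly above
    -- `x`. This makes `x` a weak point and also dominated by `f x`.
    have habove : ∀ d ∈ (inl f '' D)ᶜ, inl f x ⤳ d → d ≠ inl f x → inr f (f x) ⤳ d := by
      refine ind (fun z hz hxz hne => ?_) fun y _ hxy _ => ?_
      · exact (hz ⟨z, hD z ⟨(inl_specializes_inl f).1 hxz, fun h => hne (h ▸ rfl)⟩, rfl⟩).elim
      · exact (inr_specializes_inr f).2 ((inl_specializes_inr f).1 hxy)
    rw [hins]
    refine ⟨ih.1.tail ⟨⟨_, hxA⟩, isWeakPoint_of_above _ ?_, rfl⟩,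
      ih.2.trans (chainComplex_collapses_of_dominated hcA (inl_ne_inr f).symm fun d hd h => ?_)⟩
    · refine contractibleSpace_of_forall_specializes
        ⟨inr f (f x), hcA, hxc, (inl_ne_inr f).symm⟩ fun d => ?_
      exact (subtype_specializes_iff _ _).2 (habove d d.2.1 d.2.2.1 d.2.2.2)
    · by_cases hdx : d = inl f x
      · exact .inl (hdx ▸ hxc)
      · exact h.imp (fun h => h.trans hxc) fun h => habove d hd h hdx
  convert! key using 1
  ext z
  induction z using ind with
  | h1 x => simp [(inl_ne_inr f).symm, (inl_injective f).eq_iff]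
  | h2 y => simp [inl_ne_inr f, (inr_injective f).eq_iff]

theorem isEmbedding_inl [T0Space X] : IsEmbedding (inl f) :=
  isEmbedding_of_specializes_iff fun _ _ => inl_specializes_inl f

theorem isEmbedding_inr [T0Space Y] : IsEmbedding (inr f) :=
  isEmbedding_of_specializes_iff fun _ _ => inr_specializes_inr f

variable {f} in
/-- If `f` is distinguished, the points of `Y` may be removed from the cylinder from bottom to
top. -/
theorem collapsesTo_range_inl [T0Space X] [T0Space Y] (hf : IsDistinguished f) :
    CollapsesTo (Set.range (inl f)) := by
  have key : CollapsesTo (inr f '' Set.univ)ᶜ := by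
    refine univ_of_insert (P := fun D => CollapsesTo (inr f '' D)ᶜ)
      (wellFounded_specializes (X := Y)) ?_ fun D y hy hD ih => ?_
    · simp only [Set.image_empty, Set.compl_empty]
      exact ⟨.refl, .refl⟩
    have hyA : inr f y ∈ (inr f '' D)ᶜ := by
      rwa [Set.mem_compl_iff, (inr_injective f).mem_set_image]
    have hins : (inr f '' insert y D)ᶜ = (inr f '' D)ᶜ \ {inr f y} := by
      rw [Set.image_insert_eq, Set.sdiff_eq, ← Set.compl_union, Set.insert_eq, Set.union_comm]
    -- The points of `Y` strictly below `y` are gone, so only points of `X` remain below it.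
    have hbelow : inl f '' (f ⁻¹' minOpen y) =
        {b | b ∈ (inr f '' D)ᶜ ∧ b ⤳ inr f y ∧ b ≠ inr f y} := by
      ext b
      constructor
      · rintro ⟨x, hx, rfl⟩
        refine ⟨?_, (inl_specializes_inr f).2 (mem_minOpen_iff.1 hx), inl_ne_inr f⟩
        rintro ⟨_, _, h⟩
        exact inl_ne_inr f h.symm
      · induction b using ind with
        | h1 x => exact fun h => ⟨x, mem_minOpen_iff.2 ((inl_specializes_inr f).1 h.2.1), rfl⟩
        | h2 z =>
          rintro ⟨hz, hzy, hne⟩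
          exact (hz ⟨z, hD z ⟨(inr_specializes_inr f).1 hzy, fun h => hne (h ▸ rfl)⟩, rfl⟩).elim
    have hcontr : ContractibleSpace {b | b ∈ (inr f '' D)ᶜ ∧ b ⤳ inr f y ∧ b ≠ inr f y} := by
      rw [← hbelow]
      have := hf y
      exact ((isEmbedding_inl f).homeomorphImage _).symm.contractibleSpace
    rw [hins]
    exact ⟨ih.1.tail ⟨⟨_, hyA⟩, isWeakPoint_of_below _ hcontr, rfl⟩,
      ih.2.trans (chainComplex_collapses_of_dismantlable
        (dismantlable_of_contractibleSpace _))⟩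
  convert! key using 1
  ext z
  induction z using ind with
  | h1 x => simp [(inl_ne_inr f).symm, (inl_injective f).eq_iff]
  | h2 y => simp [inl_ne_inr f, (inr_injective f).eq_iff]

/-- The retraction of the cylinder onto `Y`. -/
def retraction : C(Cylinder f, Y) where
  toFun := Sum.elim f id
  continuous_toFun := continuous_of_specializes <| by
    refine ind (fun a => ind (fun b h => ?_) fun b h => ?_)
      fun a => ind (fun b h => ?_) fun b h => ?_
    · exact ((inl_specializes_inl f).1 h).map f.continuous
    · exact (inl_specializes_inr f).1 h
    · exact (not_inr_specializes_inl f h).elim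
    · exact (inr_specializes_inr f).1 h

end Cylinder

end FiniteSpaces

end

/-! ### The main theorem -/

theorem mainTheorem4 {X Y : Type u} [TopologicalSpace X] [T0Space X] [Fintype X]
    [TopologicalSpace Y] [T0Space Y] [Fintype Y] (f : C(X, Y))
    (hf : FiniteSpaces.IsDistinguished f) :
    FiniteSpaces.IsSimpleHomotopyEquiv (FiniteSpaces.orderComplexMap f).realize ∧
      FiniteSpaces.IsSpaceExpansion (FiniteSpaces.Cylinder.inl f) ∧
      FiniteSpaces.IsSpaceExpansion (FiniteSpaces.Cylinder.inr f) := by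
  open FiniteSpaces Cylinder in
  have hX := collapsesTo_range_inl hf
  have hY := collapsesTo_range_inr f
  refine ⟨?_, ⟨isEmbedding_inl f, hX.1⟩, ⟨isEmbedding_inr f, hY.1⟩⟩
  let _ : Fintype (Cylinder f) := Fintype.ofFinite _
  let i : C(X, Cylinder f) := ⟨inl f, (isEmbedding_inl f).continuous⟩
  let j : C(Y, Cylinder f) := ⟨inr f, (isEmbedding_inr f).continuous⟩
  have hi : (orderComplexMap i).IsExpansion :=
    isExpansion_orderComplexMap i (isEmbedding_inl f) hX.2
  have hj : (orderComplexMap j).IsExpansion :=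
    isExpansion_orderComplexMap j (isEmbedding_inr f) hY.2
  obtain ⟨gi, hgi⟩ := hi.isHomotopyInverse
  obtain ⟨gj, hgj⟩ := hj.isHomotopyInverse
  -- The retraction is a strict left inverse of `j`, and `j` realizes to a homotopy equivalence, so
  -- it may replace `gj`.
  have hr : IsHomotopyInverse (orderComplexMap (retraction f)).realize
      (orderComplexMap j).realize :=
    hgj.of_comp_eq_id ((orderComplexMap_realize_comp _ _).trans orderComplexMap_realize_id)
  -- The factorization is an equality because `retraction f` restricts to `f` on `X`; the homotopy
  -- required at the end is therefore constant.
  have hF : (orderComplexMap f).realize =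
      (orderComplexMap (retraction f)).realize.comp (orderComplexMap i).realize :=
    (orderComplexMap_realize_comp i (retraction f)).symm
  refine ⟨⟨gi.comp (orderComplexMap j).realize, hF ▸ hgi.comp hr.symm⟩, _,
    .contract (.expand (.refl _) _ hi) _ hj _ hr, ?_⟩
  rw [hF]
  exact .refl _
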